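/- Let $N\ge 2$ particles occupy $M$ external modes, with Hilbert space $(\mathbb{C}^M)^{\otimes N}$, computational basis $|l_1,\dots,l_N\rangle$, $l_i\in\{1,\dots,M\}$, and $\pi\in S_N$ acting by $\pi|l_1,\dots,l_N\rangle=|l_{\pi(1)},\dots,l_{\pi(N)}\rangle$. Let $\mathrm{Inv}$ be the set of density matrices $\varrho$ on this space with $\pi\varrho\pi^\dagger=\varrho$ for all $\pi\in S_N$. For $k\le N$ let $p_k(\varrho)=\mathrm{tr}[(P^{(k)}\otimes\mathbb{1}^{\otimes(N-k)})\varrho]$, where $P^{(k)}=\frac1{k!}\sum_{\pi\in S_k}\pi$ is the projector onto the symmetric subspace of $k$ particles. For real $q$ put $$b(q)=\begin{cases}0 & \text{if } q\le\frac{N-2}{N-1},\\ (N-1)q-(N-2) & \text{otherwise.}\end{cases}$$ Then for every $\varrho\in\mathrm{Inv}$, $$b(p_2(\varrho))\le p_N(\varrho)\le p_2(\varrho).$$ Both bounds are tight, in the following sense. (i) For every $M$ and every value $q$ that $p_2$ takes on $\mathrm{Inv}$, $b(q)=\min\{p_N(\varrho):\varrho\in\mathrm{Inv},\ p_2(\varrho)=q\}$.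 (ii) If $M\ge N$, then for every $q\in[0,1]$ the minimum and the maximum of $p_N(\varrho)$ over all $\varrho\in\mathrm{Inv}$ with $p_2(\varrho)=q$ are $b(q)$ and $q$. (iii) Let $\boldsymbol l=(l_1,\dots,l_N)$ be pairwise distinct modes and $\boldsymbol m$ the mode occupation with one particle in each of them and none in the others. A state $\varrho\in\mathrm{Inv}$ has fixed mode occupation $\boldsymbol m$ if $n_j\varrho=m_j\varrho$ for every mode $j$, where $n_j$ is the particle number operator of mode $j$. For every $q\in[0,1]$ the minimum and maximum in (ii) remain $b(q)$ and $q$ when restricted to states of fixed mode occupation $\boldsymbol m$. With the Dicke state $|D\rangle=\frac1{\sqrt{N!}}\sum_{\pi\in S_N}\pi|\boldsymbol l\rangle$ and the totally antisymmetric state $|A\rangle=\frac1{\sqrt{N!}}\sum_{\pi\in S_N}\mathrm{sign}(\pi)\,\pi|\boldsymbol l\rangle$, the maximum is attained by $q|D\rangle\langle D|+(1-q)|A\rangle\langle A|$, and the minimum is attained by $b(q)|D\rangle\langle D|+(1-b(q))\sigma$ for some $\sigma\in\mathrm{Inv}$ of fixed mode occupation $\boldsymbol m$ with $p_N(\sigma)=0$.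 -/

import Mathlib

open scoped ComplexOrder

namespace Bosons

/-- Mode assignment vectors `(l_1, …, l_N)`: particle `i` sits in mode `l i`.
They label the computational basis of the external space `(ℂ^M)^{⊗ N}`. -/
abbrev Assignment (N M : ℕ) : Type := Fin N → Fin M

/-- Vectors of `(ℂ^M)^{⊗ N}` in the computational basis. -/
abbrev Vec (N M : ℕ) : Type := Assignment N M → ℂ

/-- Operators on `(ℂ^M)^{⊗ N}` in the computational basis. -/
abbrev Op (N M : ℕ) : Type := Matrix (Assignment N M) (Assignment N M) ℂ

/-- The basis vector `|l⟩`. -/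
def ket {N M : ℕ} (l : Assignment N M) : Vec N M := Pi.single l 1

/-- The operator `|v⟩⟨v|`. -/
def ketbra {N M : ℕ} (v : Vec N M) : Op N M := Matrix.vecMulVec v (star v)

/-- The operator permuting the particles, `π |l⟩ = |l_{π(1)}, …, l_{π(N)}⟩`. -/
def permOp {N : ℕ} (M : ℕ) (π : Equiv.Perm (Fin N)) : Op N M :=
  Matrix.of fun l' l => if l' = l ∘ π then 1 else 0

/-- `Inv`: the permutation-invariant density matrices of `N` particles in `M` modes. -/
def Inv (N M : ℕ) : Set (Op N M) :=
  {ρ | (∀ π : Equiv.Perm (Fin N), permOp M π * ρ * (permOp M π).conjTranspose = ρ) ∧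
    ρ.PosSemidef ∧ ρ.trace = 1}

/-- `P^{(k)} = (1/k!) ∑_π π`, the projector onto the symmetric subspace of `(ℂ^M)^{⊗ k}`. -/
noncomputable def symProj (k M : ℕ) : Op k M :=
  (1 / (k.factorial : ℂ)) • ∑ π : Equiv.Perm (Fin k), permOp M π

/-- `P^{(k)} ⊗ 1` on `(ℂ^M)^{⊗ N}`: `P^{(k)}` on the first `k` particles, the identity on the
remaining `N - k`. -/
noncomputable def symProjFirst {k N : ℕ} (M : ℕ) (h : k ≤ N) : Op N M :=
  Matrix.of fun l' l =>
    symProj k M (l' ∘ Fin.castLE h) (l ∘ Fin.castLE h) *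
      (if ∀ i : Fin N, k ≤ (i : ℕ) → l' i = l i then 1 else 0)

/-- `p_k = tr[(P^{(k)} ⊗ 1) ρ]`. For a density matrix `ρ` the trace is a real number, so that
taking the real part only changes its type. -/
noncomputable def symWeight {k N M : ℕ} (h : k ≤ N) (ρ : Op N M) : ℝ :=
  (Matrix.trace (symProjFirst M h * ρ)).re

/-- The lower bound `b` on `p_N` as a function of `q = p_2`. -/
noncomputable def lowerBound (N : ℕ) (q : ℝ) : ℝ :=
  if q ≤ ((N : ℝ) - 2) / ((N : ℝ) - 1) then 0 else ((N : ℝ) - 1) * q - ((N : ℝ) - 2)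

/-- The mode occupation `m_j`, the number of particles in mode `j`. -/
def occupation {N M : ℕ} (l : Assignment N M) (j : Fin M) : ℕ :=
  (Finset.univ.filter fun i => l i = j).card

/-- The particle number operator of mode `j`. -/
def numberOp (N : ℕ) {M : ℕ} (j : Fin M) : Op N M :=
  Matrix.diagonal fun l => (occupation l j : ℂ)

/-- The states of fixed mode occupation `m`: the permutation-invariant density matrices all of
whose range consists of eigenvectors of each number operator, with eigenvalue `m j`. -/
def InvFixed (N : ℕ) {M : ℕ} (m : Fin M → ℕ) : Set (Op N M) :=
  {ρ | ρ ∈ Inv N M ∧ ∀ j : Fin M, numberOp N j * ρ = (m j : ℂ) • ρ}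

/-- The possible values of `p_N` for the states in `S` that have `p_2 = q`. -/
def weightValues {N M : ℕ} (hN : 2 ≤ N) (S : Set (Op N M)) (q : ℝ) : Set ℝ :=
  {x | ∃ ρ ∈ S, symWeight hN ρ = q ∧ symWeight (le_refl N) ρ = x}

/-- The Dicke state `(1/√N!) ∑_π π|l⟩`, normalized for `l` with pairwise distinct entries. -/
noncomputable def dicke {N M : ℕ} (l : Assignment N M) : Vec N M :=
  (1 / (Real.sqrt (N.factorial : ℝ) : ℂ)) •
    ∑ π : Equiv.Perm (Fin N), (permOp M π).mulVec (ket l)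

/-- The totally antisymmetric state `(1/√N!) ∑_π sign(π) π|l⟩`, normalized for `l` with pairwise
distinct entries. -/
noncomputable def antisymState {N M : ℕ} (l : Assignment N M) : Vec N M :=
  (1 / (Real.sqrt (N.factorial : ℝ) : ℂ)) •
    ∑ π : Equiv.Perm (Fin N),
      ((Equiv.Perm.sign π : ℤ) : ℂ) • (permOp M π).mulVec (ket l)

/-- The mixture `α ρ + (1 - α) σ`. -/
noncomputable def mix {N M : ℕ} (α : ℝ) (ρ σ : Op N M) : Op N M :=
  (α : ℂ) • ρ + ((1 - α : ℝ) : ℂ) • σ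

end Bosons

/-! For a set `A` of particles let `symOn M A` be the projector onto vectors symmetric in `A`, and
p_A its expectation; p_2 and p_N are the cases of a pair and of all particles. Enlarging `A` shrinks
the projector, which gives the upper bound.

For the lower bound, let n = |A|, P = `symOn M A`, and let S be the sum of the projectors Q_j that
leave out one j in `A`. The symmetric group algebra gives (n-1)S² = nS + n²(n-2)P
(`sum_symOn_erase_mul_self`). For n ≥ 2, S is therefore n on the range of P and only 0 or n/(n-1) on
its complement, whence (n-1)S ≤ n + n(n-2)P. By invariance all Q_j have the same expectation, so
(n-2)(1-p_n) ≤ (n-1)(1-p_{n-1}) (`expect_symOn_erase_bound`). Telescoping from the pair to all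
particles yields 1-p_N ≤ (N-1)(1-p_2).

For tightness, the kink of the bound is realized by a state of type (N-1,1), with p_N = 0 and p_2 =
(N-2)/(N-1) (`exists_standard_state`). Mixing it with a symmetric state covers larger q; mixing it
with a state with p_N = 0 and smaller p_2 covers the rest (`exists_attains_lowerBound`). -/

open scoped ComplexOrder

namespace Bosons

/-! ### Permutation operators and the algebra of partial symmetrizers -/

section PermutationOperators

variable {N M : ℕ}

/-- Permutations act by precomposition, so the order of the product is reversed. -/
theorem permOp_mul (π σ : Equiv.Perm (Fin N)) :
    permOp M π * permOp M σ = permOp M (σ * π) := by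
  ext a b
  simp only [permOp, Matrix.mul_apply, Matrix.of_apply, mul_ite, mul_one, mul_zero]
  rw [Finset.sum_eq_single (b ∘ σ)]
  · simp only [if_true, Function.comp_assoc, Equiv.Perm.coe_mul]
    congr
  · intro c _ hc
    simp [hc]
  · simp

theorem permOp_one : permOp M (1 : Equiv.Perm (Fin N)) = 1 := by
  ext a b
  simp [permOp, Matrix.one_apply]

theorem permOp_conjTranspose (π : Equiv.Perm (Fin N)) :
    (permOp M π).conjTranspose = permOp M π⁻¹ := by
  ext a b
  have h : b = a ∘ π ↔ a = b ∘ (π⁻¹ : Equiv.Perm (Fin N)) := by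
    constructor
    · rintro rfl
      ext i; simp
    · rintro rfl
      ext i; simp
  simp only [permOp, Matrix.conjTranspose_apply, Matrix.of_apply, h]
  split_ifs <;> simp

theorem permOp_inv_mul (π : Equiv.Perm (Fin N)) :
    permOp M π⁻¹ * permOp M π = 1 := by
  rw [permOp_mul, mul_inv_cancel, permOp_one]

/-- The permutations that move only points of `A`. -/
def permsWithin (A : Finset (Fin N)) : Finset (Equiv.Perm (Fin N)) :=
  Finset.univ.filter fun π => ∀ x, x ∉ A → π x = x

theorem mem_permsWithin {A : Finset (Fin N)} {π : Equiv.Perm (Fin N)} :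
    π ∈ permsWithin A ↔ ∀ x, x ∉ A → π x = x := by
  simp [permsWithin]

theorem one_mem_permsWithin (A : Finset (Fin N)) : 1 ∈ permsWithin A := by
  simp [mem_permsWithin]

theorem mul_mem_permsWithin {A : Finset (Fin N)} {π σ : Equiv.Perm (Fin N)}
    (hπ : π ∈ permsWithin A) (hσ : σ ∈ permsWithin A) : π * σ ∈ permsWithin A := by
  rw [mem_permsWithin] at *
  intro x hx
  rw [Equiv.Perm.mul_apply, hσ x hx, hπ x hx]

theorem inv_mem_permsWithin {A : Finset (Fin N)} {π : Equiv.Perm (Fin N)}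
    (hπ : π ∈ permsWithin A) : π⁻¹ ∈ permsWithin A := by
  rw [mem_permsWithin] at *
  intro x hx
  rw [Equiv.Perm.inv_eq_iff_eq, hπ x hx]

theorem swap_mem_permsWithin {A : Finset (Fin N)} {i j : Fin N} (hi : i ∈ A) (hj : j ∈ A) :
    Equiv.swap i j ∈ permsWithin A := by
  rw [mem_permsWithin]
  intro x hx
  exact Equiv.swap_apply_of_ne_of_ne (fun h => hx (h ▸ hi)) (fun h => hx (h ▸ hj))

theorem permsWithin_mono {A B : Finset (Fin N)} (h : A ⊆ B) : permsWithin A ⊆ permsWithin B := by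
  intro π hπ
  rw [mem_permsWithin] at *
  exact fun x hx => hπ x fun hxA => hx (h hxA)

theorem permsWithin_card_pos (A : Finset (Fin N)) : 0 < (permsWithin A).card :=
  Finset.card_pos.2 ⟨1, one_mem_permsWithin A⟩

theorem permsWithin_singleton (i : Fin N) : permsWithin {i} = {1} := by
  ext π
  rw [mem_permsWithin, Finset.mem_singleton]
  constructor
  · intro h
    ext x
    by_cases hx : x = i
    · subst hx
      by_contra hne
      have hne' : π x ≠ x := fun h' => hne (by simp [h'])
      have := h (π x) (by simpa using hne')
      exact hne' (π.injective this)
    · simp [h x (by simpa using hx)]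
  · rintro rfl x _
    rfl

/-- Each permutation within `A` is uniquely a permutation within `A \ {i}` followed by a swap of
`i` with a point of `A`. -/
theorem sum_permsWithin {β : Type*} [AddCommMonoid β] {A : Finset (Fin N)} {i : Fin N}
    (hi : i ∈ A) (f : Equiv.Perm (Fin N) → β) :
    ∑ π ∈ permsWithin A, f π =
      ∑ j ∈ A, ∑ σ ∈ permsWithin (A.erase i), f (Equiv.swap i j * σ) := by
  rw [← Finset.sum_product']
  symm
  have hfix : ∀ σ ∈ permsWithin (A.erase i), σ i = i := fun σ hσ =>
    mem_permsWithin.1 hσ i (by simp)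
  refine Finset.sum_bij' (fun p _ => Equiv.swap i p.1 * p.2)
    (fun π _ => (π i, Equiv.swap i (π i) * π)) ?_ ?_ ?_ ?_ ?_
  · rintro ⟨j, σ⟩ h
    rw [Finset.mem_product] at h
    exact mul_mem_permsWithin (swap_mem_permsWithin hi h.1)
      (permsWithin_mono (Finset.erase_subset _ _) h.2)
  · intro π hπ
    have hπ' := mem_permsWithin.1 hπ
    have hmem : π i ∈ A := by
      by_contra h
      have := hπ' _ h
      exact h (by rw [π.injective this]; exact hi)
    refine Finset.mem_product.2 ⟨hmem, mem_permsWithin.2 fun x hx => ?_⟩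
    by_cases hxi : x = i
    · subst hxi
      simp
    · have hxA : x ∉ A := fun h => hx (Finset.mem_erase.2 ⟨hxi, h⟩)
      exact mem_permsWithin.1 (mul_mem_permsWithin (swap_mem_permsWithin hi hmem) hπ) x hxA
  · rintro ⟨j, σ⟩ h
    have hσ := hfix σ (Finset.mem_product.1 h).2
    have hj : (Equiv.swap i j * σ) i = j := by simp [hσ]
    ext1
    · exact hj
    · simp only [hj, Equiv.swap_mul_self_mul]
  · intro π _
    simp
  · intros
    rfl

theorem permsWithin_card_erase {A : Finset (Fin N)} {i : Fin N} (hi : i ∈ A) :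
    (permsWithin A).card = A.card * (permsWithin (A.erase i)).card := by
  have h := sum_permsWithin hi (fun _ => (1 : ℕ))
  simpa using h

/-- The projector onto the vectors that are symmetric in the particles of `A`. -/
noncomputable def symOn (M : ℕ) (A : Finset (Fin N)) : Op N M :=
  ((permsWithin A).card : ℂ)⁻¹ • ∑ π ∈ permsWithin A, permOp M π

theorem card_smul_symOn (A : Finset (Fin N)) :
    ((permsWithin A).card : ℂ) • symOn M A = ∑ π ∈ permsWithin A, permOp M π := by
  rw [symOn, smul_smul, mul_inv_cancel₀, one_smul]
  exact_mod_cast (permsWithin_card_pos A).ne'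

theorem symOn_mul_permOp {A : Finset (Fin N)} {σ : Equiv.Perm (Fin N)} (hσ : σ ∈ permsWithin A) :
    symOn M A * permOp M σ = symOn M A := by
  rw [symOn, Matrix.smul_mul, Finset.sum_mul]
  congr 1
  simp only [permOp_mul]
  refine Finset.sum_bij' (fun π _ => σ * π) (fun π _ => σ⁻¹ * π) ?_ ?_ ?_ ?_ ?_
  · exact fun π hπ => mul_mem_permsWithin hσ hπ
  · exact fun π hπ => mul_mem_permsWithin (inv_mem_permsWithin hσ) hπ
  all_goals simp

theorem symOn_conjTranspose (A : Finset (Fin N)) : (symOn M A).conjTranspose = symOn M A := by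
  simp only [symOn, Matrix.conjTranspose_smul, Matrix.conjTranspose_sum, permOp_conjTranspose]
  congr 1
  · simp
  · refine Finset.sum_bij' (fun π _ => π⁻¹) (fun π _ => π⁻¹) ?_ ?_ ?_ ?_ ?_
    · exact fun π hπ => inv_mem_permsWithin hπ
    · exact fun π hπ => inv_mem_permsWithin hπ
    all_goals simp

theorem permOp_mul_symOn {A : Finset (Fin N)} {σ : Equiv.Perm (Fin N)} (hσ : σ ∈ permsWithin A) :
    permOp M σ * symOn M A = symOn M A := by
  have h := congrArg Matrix.conjTranspose
    (symOn_mul_permOp (M := M) (inv_mem_permsWithin hσ))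
  rwa [Matrix.conjTranspose_mul, permOp_conjTranspose, symOn_conjTranspose, inv_inv] at h

theorem symOn_mul_symOn {A B : Finset (Fin N)} (h : B ⊆ A) :
    symOn M A * symOn M B = symOn M A := by
  conv_lhs => rw [symOn.eq_def M B, Matrix.mul_smul, Finset.mul_sum,
    Finset.sum_congr rfl fun π hπ => symOn_mul_permOp (permsWithin_mono h hπ),
    Finset.sum_const, ← Nat.cast_smul_eq_nsmul ℂ, smul_smul]
  rw [inv_mul_cancel₀, one_smul]
  exact_mod_cast (permsWithin_card_pos B).ne'

theorem symOn_mul_symOn' {A B : Finset (Fin N)} (h : B ⊆ A) :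
    symOn M B * symOn M A = symOn M A := by
  have h := congrArg Matrix.conjTranspose (symOn_mul_symOn (M := M) h)
  rwa [Matrix.conjTranspose_mul, symOn_conjTranspose, symOn_conjTranspose] at h

theorem symOn_singleton (i : Fin N) : symOn M {i} = 1 := by
  simp [symOn, permsWithin_singleton, permOp_one]

/-- The coset decomposition of the permutations of `A` over the stabilizer of `i`, averaged. -/
theorem sum_symOn_erase_mul_swap {A : Finset (Fin N)} {i : Fin N} (hi : i ∈ A) :
    ∑ j ∈ A, symOn M (A.erase i) * permOp M (Equiv.swap i j) = (A.card : ℂ) • symOn M A := by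
  have hc : ((permsWithin (A.erase i)).card : ℂ) ≠ 0 := by
    exact_mod_cast (permsWithin_card_pos _).ne'
  refine smul_right_injective _ hc ?_
  simp only
  rw [smul_smul, mul_comm, ← Nat.cast_mul, ← permsWithin_card_erase hi, card_smul_symOn,
    sum_permsWithin hi, Finset.smul_sum]
  refine Finset.sum_congr rfl fun j _ => ?_
  rw [← Matrix.smul_mul, card_smul_symOn, Finset.sum_mul]
  simp only [permOp_mul]

theorem permOp_mul_symOn_erase_mul {A : Finset (Fin N)} {i j : Fin N} (hi : i ∈ A) (hj : j ∈ A) :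
    permOp M (Equiv.swap i j) * symOn M (A.erase i) * permOp M (Equiv.swap i j) =
      symOn M (A.erase j) := by
  have key : ∀ {i j : Fin N}, i ∈ A → j ∈ A → ∀ π ∈ permsWithin (A.erase i),
      Equiv.swap i j * π * Equiv.swap i j ∈ permsWithin (A.erase j) := by
    intro i j hi hj π hπ
    rw [mem_permsWithin] at *
    intro x hx
    simp only [Equiv.Perm.mul_apply]
    rw [hπ, Equiv.swap_apply_self]
    intro h
    apply hx
    rw [Finset.mem_erase] at h ⊢
    refine ⟨fun hxj => h.1 (by rw [hxj, Equiv.swap_apply_right]), ?_⟩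
    by_cases h1 : x = i
    · rwa [h1]
    · by_cases h2 : x = j
      · rwa [h2]
      · rw [Equiv.swap_apply_of_ne_of_ne h1 h2] at h
        exact h.2
  have hbij : ∀ f : Equiv.Perm (Fin N) → Op N M,
      ∑ π ∈ permsWithin (A.erase i), f (Equiv.swap i j * (π * Equiv.swap i j)) =
        ∑ π ∈ permsWithin (A.erase j), f π := by
    intro f
    refine Finset.sum_bij' (fun π _ => Equiv.swap i j * (π * Equiv.swap i j))
      (fun π _ => Equiv.swap i j * π * Equiv.swap i j) ?_ ?_ ?_ ?_ ?_
    · intro π hπ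
      rw [← mul_assoc]
      exact key hi hj π hπ
    · intro π hπ
      rw [Equiv.swap_comm]
      exact key hj hi π hπ
    · intro π _
      simp [mul_assoc]
    · intro π _
      simp [mul_assoc]
    · intros
      rfl
  have hcard : (permsWithin (A.erase i)).card = (permsWithin (A.erase j)).card := by
    have h1 := permsWithin_card_erase hi
    rw [permsWithin_card_erase hj] at h1
    exact (Nat.eq_of_mul_eq_mul_left (Finset.card_pos.2 ⟨i, hi⟩) h1).symm
  rw [symOn, symOn, hcard, ← hbij]
  simp only [Matrix.mul_smul, Matrix.smul_mul, Finset.mul_sum, Finset.sum_mul, permOp_mul]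

/-- Reduces p_2 to the expectation of a single swap. -/
theorem symOn_pair {i j : Fin N} (hij : i ≠ j) :
    symOn M {i, j} = (1 / 2 : ℂ) • (1 + permOp M (Equiv.swap i j)) := by
  have h := sum_symOn_erase_mul_swap (M := M) (A := {i, j}) (i := i) (by simp)
  have he : ({i, j} : Finset (Fin N)).erase i = {j} := by
    ext x
    simp only [Finset.mem_erase, Finset.mem_insert, Finset.mem_singleton]
    constructor
    · rintro ⟨h1, h2 | h2⟩
      · exact absurd h2 h1
      · exact h2
    · rintro rfl
      exact ⟨hij.symm, Or.inr rfl⟩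
  rw [he, symOn_singleton, Finset.sum_pair hij, Finset.card_pair hij, Equiv.swap_self] at h
  have h1 : permOp M (Equiv.refl (Fin N)) = 1 := permOp_one
  rw [h1, one_mul, one_mul] at h
  rw [h, smul_smul]
  norm_num

/-- Two projectors `Q_i`, `Q_j` that each leave out one particle of `A`. -/
theorem symOn_erase_mul_symOn_erase {A : Finset (Fin N)} {i j : Fin N} (hi : i ∈ A) (hj : j ∈ A)
    (hij : i ≠ j) :
    ((A.card : ℂ) - 1) • (symOn M (A.erase i) * symOn M (A.erase j)) =
      (A.card : ℂ) • symOn M A - symOn M (A.erase i) * permOp M (Equiv.swap i j) := by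
  set Q := symOn M (A.erase i) with hQ
  have hQQ : Q * Q = Q := symOn_mul_symOn (Finset.Subset.refl _)
  -- (i k) is (i j) conjugated by (j k), and `Q` absorbs (j k) on either side.
  have hsame : ∀ k ∈ A.erase i, Q * permOp M (Equiv.swap i k) * Q =
      Q * permOp M (Equiv.swap i j) * Q := by
    intro k hk
    by_cases hkj : k = j
    · rw [hkj]
    have hki := (Finset.mem_erase.1 hk).1
    have hs : Equiv.swap j k ∈ permsWithin (A.erase i) :=
      swap_mem_permsWithin (Finset.mem_erase.2 ⟨hij.symm, hj⟩) hk
    have hconj : Equiv.swap i k = Equiv.swap j k * (Equiv.swap i j * Equiv.swap j k) := by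
      have := Equiv.swap_mul_swap_mul_swap (x := i) (y := j) (z := k) hij hki.symm
      rw [← mul_assoc, this, Equiv.swap_comm]
    rw [hconj, ← permOp_mul, ← permOp_mul]
    calc Q * (permOp M (Equiv.swap j k) * permOp M (Equiv.swap i j) * permOp M (Equiv.swap j k)) * Q
        = (Q * permOp M (Equiv.swap j k)) * permOp M (Equiv.swap i j) *
          (permOp M (Equiv.swap j k) * Q) := by simp only [mul_assoc]
      _ = _ := by rw [symOn_mul_permOp hs, permOp_mul_symOn hs]
  -- Multiply the coset decomposition by `Q` on the right: the term k = i gives `Q`, the other |A|-1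
  -- terms coincide.
  have hmid : ((A.card : ℂ) - 1) • (Q * permOp M (Equiv.swap i j) * Q) =
      (A.card : ℂ) • symOn M A - Q := by
    have h := congrArg (· * Q) (sum_symOn_erase_mul_swap (M := M) hi)
    simp only [Finset.sum_mul, ← hQ, Matrix.smul_mul] at h
    rw [symOn_mul_symOn (Finset.erase_subset i A), ← Finset.add_sum_erase _ _ hi,
      Finset.sum_congr rfl hsame, Finset.sum_const, Finset.card_erase_of_mem hi,
      Equiv.swap_self] at h
    have h1 : permOp M (Equiv.refl (Fin N)) = 1 := permOp_one
    rw [h1, mul_one, hQQ, ← Nat.cast_smul_eq_nsmul ℂ,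
      Nat.cast_sub (Finset.card_pos.2 ⟨i, hi⟩), Nat.cast_one] at h
    rw [← h, add_sub_cancel_left]
  have hss : permOp M (Equiv.swap i j) * permOp M (Equiv.swap i j) = 1 := by
    rw [permOp_mul, Equiv.swap_mul_self, permOp_one]
  calc ((A.card : ℂ) - 1) • (Q * symOn M (A.erase j))
      = ((A.card : ℂ) - 1) • (Q * permOp M (Equiv.swap i j) * Q) * permOp M (Equiv.swap i j) := by
        rw [← permOp_mul_symOn_erase_mul hi hj, Matrix.smul_mul]
        simp only [mul_assoc, hQ]
    _ = _ := by
        rw [hmid, sub_mul, Matrix.smul_mul, symOn_mul_permOp (swap_mem_permsWithin hi hj)]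

theorem symOn_erase_mul_sum {A : Finset (Fin N)} {i : Fin N} (hi : i ∈ A) :
    ((A.card : ℂ) - 1) • (symOn M (A.erase i) * ∑ j ∈ A, symOn M (A.erase j)) =
      (A.card : ℂ) • symOn M (A.erase i) + ((A.card : ℂ) * ((A.card : ℂ) - 2)) • symOn M A := by
  have hQQ : symOn M (A.erase i) * symOn M (A.erase i) = symOn M (A.erase i) :=
    symOn_mul_symOn (Finset.Subset.refl _)
  have h := sum_symOn_erase_mul_swap (M := M) hi
  have h1 : permOp M (Equiv.refl (Fin N)) = 1 := permOp_one
  rw [← Finset.add_sum_erase _ _ hi, Equiv.swap_self, h1, mul_one] at h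
  rw [← Finset.add_sum_erase _ _ hi, mul_add, smul_add, hQQ, Finset.mul_sum, Finset.smul_sum,
    Finset.sum_congr rfl fun j hj => symOn_erase_mul_symOn_erase hi (Finset.mem_of_mem_erase hj)
      (Finset.ne_of_mem_erase hj).symm,
    Finset.sum_sub_distrib, eq_sub_of_add_eq' h, Finset.sum_const, Finset.card_erase_of_mem hi,
    ← Nat.cast_smul_eq_nsmul ℂ, Nat.cast_sub (Finset.card_pos.2 ⟨i, hi⟩), Nat.cast_one]
  module

theorem sum_symOn_erase_mul_self (A : Finset (Fin N)) :
    ((A.card : ℂ) - 1) • ((∑ j ∈ A, symOn M (A.erase j)) * ∑ j ∈ A, symOn M (A.erase j)) =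
      (A.card : ℂ) • (∑ j ∈ A, symOn M (A.erase j)) +
        ((A.card : ℂ) ^ 2 * ((A.card : ℂ) - 2)) • symOn M A := by
  rw [Finset.sum_mul, Finset.smul_sum,
    Finset.sum_congr rfl fun j hj => symOn_erase_mul_sum hj, Finset.sum_add_distrib,
    Finset.sum_const, ← Nat.cast_smul_eq_nsmul ℂ, ← Finset.smul_sum, smul_smul]
  congr 2
  ring

/-- The deficit of the sum of the projectors `Q_j` from its spectral bound. -/
noncomputable def eraseDeficit (M : ℕ) (A : Finset (Fin N)) : Op N M :=
  (A.card : ℂ) • (1 : Op N M) + ((A.card : ℂ) * ((A.card : ℂ) - 2)) • symOn M A -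
    ((A.card : ℂ) - 1) • ∑ j ∈ A, symOn M (A.erase j)

theorem eraseDeficit_conjTranspose (A : Finset (Fin N)) :
    (eraseDeficit M A).conjTranspose = eraseDeficit M A := by
  simp [eraseDeficit, Matrix.conjTranspose_smul, Matrix.conjTranspose_sum, symOn_conjTranspose]

/-- For nonempty `A` the deficit is thus |A| times a projector, so it is positive and no spectral
decomposition is needed. -/
theorem eraseDeficit_mul_self (A : Finset (Fin N)) :
    eraseDeficit M A * eraseDeficit M A = (A.card : ℂ) • eraseDeficit M A := by
  have hPP : symOn M A * symOn M A = symOn M A := symOn_mul_symOn (Finset.Subset.refl _)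
  have hPS : symOn M A * ∑ j ∈ A, symOn M (A.erase j) = (A.card : ℂ) • symOn M A := by
    rw [Finset.mul_sum, Finset.sum_congr rfl fun j _ => symOn_mul_symOn (Finset.erase_subset j A),
      Finset.sum_const, Nat.cast_smul_eq_nsmul]
  have hSP : (∑ j ∈ A, symOn M (A.erase j)) * symOn M A = (A.card : ℂ) • symOn M A := by
    rw [Finset.sum_mul, Finset.sum_congr rfl fun j _ => symOn_mul_symOn' (Finset.erase_subset j A),
      Finset.sum_const, Nat.cast_smul_eq_nsmul]
  have hSS := sum_symOn_erase_mul_self (M := M) A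
  unfold eraseDeficit
  generalize (∑ j ∈ A, symOn M (A.erase j)) = S at *
  generalize symOn M A = P at *
  generalize (A.card : ℂ) = n at *
  simp only [sub_mul, mul_sub, add_mul, mul_add, Matrix.smul_mul, Matrix.mul_smul, one_mul,
    mul_one, hPP, hPS, hSP, hSS]
  module

end PermutationOperators

/-! ### Expectations in invariant states and the two bounds -/

section Expectation

variable {N M : ℕ}

/-- The real part of `tr(X ρ)`. -/
noncomputable def expect (X ρ : Op N M) : ℝ := (Matrix.trace (X * ρ)).re

theorem expect_add (X Y ρ : Op N M) : expect (X + Y) ρ = expect X ρ + expect Y ρ := by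
  simp [expect, add_mul]

theorem expect_sub (X Y ρ : Op N M) : expect (X - Y) ρ = expect X ρ - expect Y ρ := by
  simp [expect, sub_mul]

theorem expect_smul (r : ℝ) (X ρ : Op N M) : expect ((r : ℂ) • X) ρ = r * expect X ρ := by
  simp [expect]

theorem expect_smul_right (r : ℝ) (X ρ : Op N M) : expect X ((r : ℂ) • ρ) = r * expect X ρ := by
  simp [expect]

theorem expect_sum {ι : Type*} (s : Finset ι) (X : ι → Op N M) (ρ : Op N M) :
    expect (∑ i ∈ s, X i) ρ = ∑ i ∈ s, expect (X i) ρ := by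
  simp [expect, Finset.sum_mul, Matrix.trace_sum]

theorem expect_one {ρ : Op N M} (hρ : ρ.trace = 1) : expect 1 ρ = 1 := by
  simp [expect, hρ]

theorem expect_mix (X : Op N M) (α : ℝ) (ρ σ : Op N M) :
    expect X (mix α ρ σ) = α * expect X ρ + (1 - α) * expect X σ := by
  rw [← expect_smul_right, ← expect_smul_right, mix]
  simp [expect, mul_add]

theorem expect_conjTranspose_mul_self_nonneg {ρ : Op N M} (hρ : ρ.PosSemidef) (Y : Op N M) :
    0 ≤ expect (Y.conjTranspose * Y) ρ := by
  have h := (hρ.mul_mul_conjTranspose_same Y).trace_nonneg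
  rw [Matrix.trace_mul_comm, ← mul_assoc] at h
  exact (Complex.le_def.1 h).1

theorem expect_projector_nonneg {ρ : Op N M} (hρ : ρ.PosSemidef) {X : Op N M}
    (hX : X.conjTranspose = X) (hXX : X * X = X) : 0 ≤ expect X ρ := by
  have h := expect_conjTranspose_mul_self_nonneg hρ X
  rwa [hX, hXX] at h

theorem expect_symOn_nonneg {ρ : Op N M} (hρ : ρ.PosSemidef) (A : Finset (Fin N)) :
    0 ≤ expect (symOn M A) ρ :=
  expect_projector_nonneg hρ (symOn_conjTranspose A) (symOn_mul_symOn (Finset.Subset.refl _))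

/-- The two projectors are nested, so their difference is again a projector. -/
theorem expect_symOn_anti {ρ : Op N M} (hρ : ρ.PosSemidef) {A B : Finset (Fin N)} (h : B ⊆ A) :
    expect (symOn M A) ρ ≤ expect (symOn M B) ρ := by
  rw [← sub_nonneg, ← expect_sub]
  refine expect_projector_nonneg hρ ?_ ?_
  · rw [Matrix.conjTranspose_sub, symOn_conjTranspose, symOn_conjTranspose]
  · rw [sub_mul, mul_sub, mul_sub, symOn_mul_symOn h, symOn_mul_symOn' h,
      symOn_mul_symOn (Finset.Subset.refl _), symOn_mul_symOn (Finset.Subset.refl _)]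
    abel

theorem expect_symOn_le_one {ρ : Op N M} (hρ : ρ ∈ Inv N M) {A : Finset (Fin N)}
    (hA : A.Nonempty) : expect (symOn M A) ρ ≤ 1 := by
  obtain ⟨i, hi⟩ := hA
  have h := expect_symOn_anti hρ.2.1 (Finset.singleton_subset_iff.2 hi)
  rwa [symOn_singleton, expect_one hρ.2.2] at h

/-- Invariance under conjugation by the particle permutations. -/
def PermInvariant (ρ : Op N M) : Prop :=
  ∀ π : Equiv.Perm (Fin N), permOp M π * ρ * (permOp M π).conjTranspose = ρ

theorem PermInvariant.commute {ρ : Op N M} (hρ : PermInvariant ρ) (π : Equiv.Perm (Fin N)) :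
    permOp M π * ρ = ρ * permOp M π := by
  conv_rhs => rw [← hρ π, permOp_conjTranspose, mul_assoc, permOp_inv_mul, mul_one]

theorem PermInvariant.expect_conj {ρ : Op N M} (hρ : PermInvariant ρ) (π : Equiv.Perm (Fin N))
    (X : Op N M) : expect (permOp M π * X * permOp M π⁻¹) ρ = expect X ρ := by
  rw [expect, mul_assoc, hρ.commute, ← mul_assoc, Matrix.trace_mul_comm, mul_assoc, ← mul_assoc,
    permOp_inv_mul, one_mul, expect]

theorem PermInvariant.commute_symOn {ρ : Op N M} (hρ : PermInvariant ρ) (A : Finset (Fin N)) :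
    symOn M A * ρ = ρ * symOn M A := by
  simp only [symOn, Matrix.smul_mul, Matrix.mul_smul, Finset.sum_mul, Finset.mul_sum, hρ.commute]

theorem PermInvariant.expect_symOn_erase {ρ : Op N M} (hρ : PermInvariant ρ) {A : Finset (Fin N)}
    {i j : Fin N} (hi : i ∈ A) (hj : j ∈ A) :
    expect (symOn M (A.erase j)) ρ = expect (symOn M (A.erase i)) ρ := by
  rw [← permOp_mul_symOn_erase_mul hi hj]
  have h := hρ.expect_conj (Equiv.swap i j) (symOn M (A.erase i))
  rwa [Equiv.swap_inv] at h

/-- Positivity of `eraseDeficit`. For |A| ≥ 3 it says that (1 - p_A)/(|A| - 1) does not increase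
when a particle is added, which is the form that telescopes. -/
theorem expect_symOn_erase_bound {ρ : Op N M} (hρ : ρ ∈ Inv N M) {A : Finset (Fin N)} {i : Fin N}
    (hi : i ∈ A) :
    ((A.card : ℝ) - 2) * (1 - expect (symOn M A) ρ) ≤
      ((A.card : ℝ) - 1) * (1 - expect (symOn M (A.erase i)) ρ) := by
  have hpos : (0 : ℝ) < A.card := by exact_mod_cast Finset.card_pos.2 ⟨i, hi⟩
  have h0 := expect_conjTranspose_mul_self_nonneg hρ.2.1 (eraseDeficit M A)
  rw [eraseDeficit_conjTranspose, eraseDeficit_mul_self] at h0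
  have hX : eraseDeficit M A = ((A.card : ℝ) : ℂ) • (1 : Op N M) +
      (((A.card : ℝ) * ((A.card : ℝ) - 2) : ℝ) : ℂ) • symOn M A -
      (((A.card : ℝ) - 1 : ℝ) : ℂ) • ∑ j ∈ A, symOn M (A.erase j) := by
    simp [eraseDeficit]
  have hc : ((A.card : ℕ) : ℂ) = ((A.card : ℝ) : ℂ) := by simp
  rw [hc, expect_smul, hX, expect_sub, expect_add, expect_smul, expect_smul, expect_smul,
    expect_sum, Finset.sum_congr rfl fun j hj => PermInvariant.expect_symOn_erase hρ.1 hi hj,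
    Finset.sum_const, expect_one hρ.2.2, nsmul_eq_mul] at h0
  have h1 := nonneg_of_mul_nonneg_right h0 hpos
  have h2 : (0 : ℝ) ≤ (A.card : ℝ) * (1 + ((A.card : ℝ) - 2) * expect (symOn M A) ρ -
      ((A.card : ℝ) - 1) * expect (symOn M (A.erase i)) ρ) := by
    linarith
  have h3 := nonneg_of_mul_nonneg_right h2 hpos
  linarith

theorem one_sub_expect_symOn_le {ρ : Op N M} (hρ : ρ ∈ Inv N M) {i j : Fin N} (hij : i ≠ j)
    (C : Finset (Fin N)) (hC : Disjoint {i, j} C) :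
    1 - expect (symOn M ({i, j} ∪ C)) ρ ≤
      ((C.card : ℝ) + 1) * (1 - expect (symOn M {i, j}) ρ) := by
  induction C using Finset.induction_on with
  | empty => simp
  | insert a C ha ih =>
    rw [Finset.disjoint_insert_right] at hC
    have ih := ih hC.2
    have haA : a ∉ {i, j} ∪ C := by
      rw [Finset.mem_union, not_or]
      exact ⟨hC.1, ha⟩
    have hb := expect_symOn_erase_bound hρ (A := insert a ({i, j} ∪ C)) (i := a) (by simp)
    rw [Finset.erase_insert haA, Finset.card_insert_of_notMem haA,
      Finset.card_union_of_disjoint hC.2, Finset.card_pair hij] at hb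
    rw [Finset.union_insert, Finset.card_insert_of_notMem ha]
    push_cast at hb ⊢
    -- The enlarged set has |C| + 3 elements, so |C| + 1 is the factor on the left of `hb`.
    have hc : (0 : ℝ) < (C.card : ℝ) + 1 := by positivity
    refine le_of_mul_le_mul_left ?_ hc
    nlinarith

theorem expect_symOn_univ_ge {ρ : Op N M} (hρ : ρ ∈ Inv N M) {i j : Fin N} (hij : i ≠ j) :
    ((N : ℝ) - 1) * expect (symOn M {i, j}) ρ - ((N : ℝ) - 2) ≤
      expect (symOn M Finset.univ) ρ := by
  have h := one_sub_expect_symOn_le hρ hij ({i, j} : Finset (Fin N))ᶜ disjoint_compl_right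
  have hN : 2 ≤ N := by
    have := Finset.card_le_univ ({i, j} : Finset (Fin N))
    rwa [Finset.card_pair hij, Fintype.card_fin] at this
  rw [Finset.union_compl, Finset.card_compl, Finset.card_pair hij, Fintype.card_fin,
    Nat.cast_sub hN] at h
  push_cast at h
  linarith

/-! ### Identification of p_2 and p_N with expectations of symmetrizers -/

theorem symProjFirst_refl : symProjFirst M (le_refl N) = symOn M (Finset.univ : Finset (Fin N)) := by
  have hall : permsWithin (Finset.univ : Finset (Fin N)) = Finset.univ := by
    ext; simp [mem_permsWithin]
  ext a b
  simp [symProjFirst, symProj, symOn, hall, Fintype.card_perm, Fin.castLE_rfl]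

theorem symProjFirst_two (hN : 2 ≤ N) :
    symProjFirst M hN = symOn M {⟨0, by lia⟩, ⟨1, by lia⟩} := by
  rw [symOn_pair (by simp)]
  have hperm : (Finset.univ : Finset (Equiv.Perm (Fin 2))) = {1, Equiv.swap 0 1} := by decide
  -- Entries are compared on the first two particles and on the rest separately; if the rest
  -- disagree, both sides vanish.
  have hsplit : ∀ {p : Fin N → Prop}, (∀ i, p i) ↔
      (p ⟨0, by lia⟩ ∧ p ⟨1, by lia⟩) ∧ ∀ i : Fin N, 2 ≤ (i : ℕ) → p i := by
    intro p
    refine ⟨fun h => ⟨⟨h _, h _⟩, fun i _ => h i⟩, fun h i => ?_⟩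
    rcases i with ⟨_ | _ | i, hi⟩
    · exact h.1.1
    · exact h.1.2
    · exact h.2 _ (by simp)
  have hswap : ∀ b : Assignment N M, ∀ i : Fin N, 2 ≤ (i : ℕ) →
      b (Equiv.swap (⟨0, by lia⟩ : Fin N) ⟨1, by lia⟩ i) = b i := by
    intro b i hi
    rw [Equiv.swap_apply_of_ne_of_ne] <;> (intro h; subst h; simp at hi)
  ext a b
  by_cases h : ∀ i : Fin N, 2 ≤ (i : ℕ) → a i = b i
  · have h' : ∀ i : Fin N, 2 ≤ (i : ℕ) →
        a i = b (Equiv.swap (⟨0, by lia⟩ : Fin N) ⟨1, by lia⟩ i) := fun i hi => by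
      rw [h i hi, hswap b i hi]
    simp only [symProjFirst, symProj, Matrix.of_apply, hperm, if_pos h, Matrix.smul_apply,
      Matrix.add_apply, Matrix.sum_apply]
    rw [Finset.sum_pair (by decide)]
    have e1 : (a ∘ Fin.castLE hN = b ∘ Fin.castLE hN) ↔ a = b := by
      rw [funext_iff, funext_iff, hsplit (p := fun i => a i = b i), and_iff_left h,
        Fin.forall_fin_two]
      rfl
    have e2 : (a ∘ Fin.castLE hN = (b ∘ Fin.castLE hN) ∘ Equiv.swap (0 : Fin 2) 1) ↔
        a = b ∘ Equiv.swap (⟨0, by lia⟩ : Fin N) ⟨1, by lia⟩ := by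
      rw [funext_iff, funext_iff,
        hsplit (p := fun i => a i = (b ∘ Equiv.swap (⟨0, by lia⟩ : Fin N) ⟨1, by lia⟩) i),
        Fin.forall_fin_two]
      simp only [Function.comp_apply, and_iff_left h', Equiv.swap_apply_left,
        Equiv.swap_apply_right]
      rfl
    simp [permOp, Matrix.one_apply, e1, e2]
  · have h' : ¬ ∀ i : Fin N, 2 ≤ (i : ℕ) →
        a i = b (Equiv.swap (⟨0, by lia⟩ : Fin N) ⟨1, by lia⟩ i) := fun h' =>
      h fun i hi => by rw [h' i hi, hswap b i hi]
    have e1 : a ≠ b := by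
      rintro rfl; exact h fun _ _ => rfl
    have e2 : a ≠ b ∘ Equiv.swap (⟨0, by lia⟩ : Fin N) ⟨1, by lia⟩ := by
      intro e; exact h' fun i _ => congrFun e i
    simp [symProjFirst, h, permOp, e1, e2]

theorem symWeight_refl (ρ : Op N M) :
    symWeight (le_refl N) ρ = expect (symOn M (Finset.univ : Finset (Fin N))) ρ := by
  rw [symWeight, symProjFirst_refl, expect]

theorem symWeight_two (hN : 2 ≤ N) (ρ : Op N M) :
    symWeight hN ρ = expect (symOn M {⟨0, by lia⟩, ⟨1, by lia⟩}) ρ := by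
  rw [symWeight, symProjFirst_two, expect]

/-- The affine branch changes sign exactly at the threshold. -/
theorem lowerBound_eq_max (hN : 2 ≤ N) (q : ℝ) :
    lowerBound N q = max 0 (((N : ℝ) - 1) * q - ((N : ℝ) - 2)) := by
  have h1 : (0 : ℝ) < (N : ℝ) - 1 := by
    have : (2 : ℝ) ≤ N := by exact_mod_cast hN
    linarith
  unfold lowerBound
  split_ifs with h
  · rw [le_div_iff₀ h1] at h
    rw [max_eq_left]
    linarith
  · rw [not_le, div_lt_iff₀ h1] at h
    rw [max_eq_right]
    linarith

theorem lowerBound_le_symWeight (hN : 2 ≤ N) {ρ : Op N M} (hρ : ρ ∈ Inv N M) :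
    lowerBound N (symWeight hN ρ) ≤ symWeight (le_refl N) ρ := by
  rw [lowerBound_eq_max hN, symWeight_refl, symWeight_two]
  exact max_le (expect_symOn_nonneg hρ.2.1 _) (expect_symOn_univ_ge hρ (by simp))

theorem symWeight_le (hN : 2 ≤ N) {ρ : Op N M} (hρ : ρ ∈ Inv N M) :
    symWeight (le_refl N) ρ ≤ symWeight hN ρ := by
  rw [symWeight_refl, symWeight_two]
  exact expect_symOn_anti hρ.2.1 (Finset.subset_univ _)

end Expectation

/-! ### Mixtures, Dicke and antisymmetric states -/

section States

variable {N M : ℕ}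

theorem mix_mem_Inv {α : ℝ} (h0 : 0 ≤ α) (h1 : α ≤ 1) {ρ σ : Op N M} (hρ : ρ ∈ Inv N M)
    (hσ : σ ∈ Inv N M) : mix α ρ σ ∈ Inv N M := by
  refine ⟨fun π => ?_, ?_, ?_⟩
  · rw [mix, mul_add, add_mul, Matrix.mul_smul, Matrix.smul_mul, Matrix.mul_smul,
      Matrix.smul_mul, hρ.1 π, hσ.1 π]
  · exact (hρ.2.1.smul (by exact_mod_cast h0)).add
      (hσ.2.1.smul (by exact_mod_cast sub_nonneg.2 h1))
  · rw [mix, Matrix.trace_add, Matrix.trace_smul, Matrix.trace_smul, hρ.2.2, hσ.2.2]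
    push_cast
    simp

theorem mix_mem_InvFixed {α : ℝ} (h0 : 0 ≤ α) (h1 : α ≤ 1) {m : Fin M → ℕ} {ρ σ : Op N M}
    (hρ : ρ ∈ InvFixed N m) (hσ : σ ∈ InvFixed N m) : mix α ρ σ ∈ InvFixed N m := by
  refine ⟨mix_mem_Inv h0 h1 hρ.1 hσ.1, fun j => ?_⟩
  rw [mix, mul_add, Matrix.mul_smul, Matrix.mul_smul, hρ.2 j, hσ.2 j]
  module

theorem exists_mix_eq {a b q : ℝ} (ha : a ≤ q) (hb : q ≤ b) :
    ∃ r : ℝ, 0 ≤ r ∧ r ≤ 1 ∧ r * b + (1 - r) * a = q := by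
  have h : q ∈ segment ℝ a b := by
    rw [segment_eq_Icc (ha.trans hb)]
    exact ⟨ha, hb⟩
  obtain ⟨s, t, hs, ht, hst, rfl⟩ := h
  refine ⟨t, ht, by linarith, ?_⟩
  rw [← hst]
  simp [smul_eq_mul]
  ring

theorem mul_ketbra_mul (X : Op N M) (v : Vec N M) :
    X * ketbra v * X.conjTranspose = ketbra (X.mulVec v) := by
  rw [ketbra, ketbra, Matrix.mul_vecMulVec, Matrix.vecMulVec_mul, Matrix.star_mulVec]

theorem ketbra_posSemidef (v : Vec N M) : (ketbra v).PosSemidef :=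
  Matrix.posSemidef_vecMulVec_self_star v

theorem ketbra_smul {c : ℂ} (hc : c * star c = 1) (v : Vec N M) : ketbra (c • v) = ketbra v := by
  rw [ketbra, ketbra, star_smul, Matrix.smul_vecMulVec, Matrix.vecMulVec_smul, smul_smul, hc,
    one_smul]

/-- The pure state of a vector that every permutation multiplies by a phase is invariant. -/
theorem ketbra_permInvariant {v : Vec N M} (χ : Equiv.Perm (Fin N) → ℂ)
    (hχ : ∀ π, χ π * star (χ π) = 1) (hv : ∀ π, (permOp M π).mulVec v = χ π • v) :
    PermInvariant (ketbra v) := fun π => by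
  rw [mul_ketbra_mul, hv, ketbra_smul (hχ π)]

theorem mul_ketbra_eq {X : Op N M} {v : Vec N M} {c : ℂ} (h : X.mulVec v = c • v) :
    X * ketbra v = c • ketbra v := by
  rw [ketbra, Matrix.mul_vecMulVec, h, Matrix.smul_vecMulVec]

theorem permOp_mulVec_ket (π : Equiv.Perm (Fin N)) (l : Assignment N M) :
    (permOp M π).mulVec (ket l) = ket (l ∘ π) := by
  ext a
  simp [ket, permOp, Pi.single_apply]

theorem occupation_comp (l : Assignment N M) (π : Equiv.Perm (Fin N)) (j : Fin M) :
    occupation (l ∘ π) j = occupation l j := by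
  unfold occupation
  refine Finset.card_bij' (fun i _ => π i) (fun i _ => π⁻¹ i) ?_ ?_ ?_ ?_ <;> simp

theorem numberOp_mulVec_ket (l : Assignment N M) (j : Fin M) :
    (numberOp N j).mulVec (ket l) = (occupation l j : ℂ) • ket l := by
  ext a
  by_cases h : a = l
  · subst h
    simp [numberOp, Matrix.mulVec_diagonal, ket]
  · simp [numberOp, Matrix.mulVec_diagonal, ket, h]

theorem numberOp_mul_permOp (π : Equiv.Perm (Fin N)) (j : Fin M) :
    numberOp N j * permOp M π = permOp M π * numberOp N j := by
  ext a b
  rw [numberOp, Matrix.diagonal_mul, Matrix.mul_diagonal]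
  simp only [permOp, Matrix.of_apply]
  split_ifs with h
  · rw [h, occupation_comp]; ring
  · simp

/-- A superposition of the permuted basis vectors `π|l⟩`. -/
noncomputable def orbitVec (l : Assignment N M) (c : Equiv.Perm (Fin N) → ℂ) : Vec N M :=
  ∑ π, c π • ket (l ∘ π)

theorem numberOp_mulVec_orbitVec (l : Assignment N M) (c : Equiv.Perm (Fin N) → ℂ) (j : Fin M) :
    (numberOp N j).mulVec (orbitVec l c) = (occupation l j : ℂ) • orbitVec l c := by
  simp only [orbitVec, Matrix.mulVec_sum, Matrix.mulVec_smul, numberOp_mulVec_ket,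
    occupation_comp, Finset.smul_sum]
  exact Finset.sum_congr rfl fun π _ => smul_comm _ _ _

theorem permOp_mulVec_orbitVec (l : Assignment N M) (c : Equiv.Perm (Fin N) → ℂ)
    (π : Equiv.Perm (Fin N)) :
    (permOp M π).mulVec (orbitVec l c) = orbitVec l fun σ => c (σ * π⁻¹) := by
  simp only [orbitVec, Matrix.mulVec_sum, Matrix.mulVec_smul, permOp_mulVec_ket]
  refine Fintype.sum_equiv (Equiv.mulRight π) _ _ fun σ => ?_
  simp [Function.comp_assoc, Equiv.Perm.coe_mul]

/-- With distinct modes the permuted kets are orthonormal. -/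
theorem trace_ketbra_orbitVec {l : Assignment N M} (hl : Function.Injective l)
    (c : Equiv.Perm (Fin N) → ℂ) : (ketbra (orbitVec l c)).trace = ∑ π, c π * star (c π) := by
  have hinj : ∀ π σ : Equiv.Perm (Fin N), l ∘ π = l ∘ σ ↔ π = σ := fun π σ => by
    rw [hl.comp_left.eq_iff, DFunLike.coe_fn_eq]
  have hval : ∀ σ : Equiv.Perm (Fin N), orbitVec l c (l ∘ σ) = c σ := by
    intro σ
    simp [orbitVec, ket, Pi.single_apply, hinj]
  rw [ketbra, Matrix.trace_vecMulVec]
  conv_lhs => enter [1]; rw [orbitVec]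
  rw [sum_dotProduct]
  refine Finset.sum_congr rfl fun π _ => ?_
  rw [smul_dotProduct, ket, single_dotProduct, one_mul, Pi.star_apply, hval, smul_eq_mul]

theorem inv_sqrt_factorial_sum (N : ℕ) (χ : Equiv.Perm (Fin N) → ℂ)
    (hχ : ∀ π, χ π * star (χ π) = 1) :
    ∑ π : Equiv.Perm (Fin N), (1 / (Real.sqrt (N.factorial : ℝ) : ℂ) * χ π) *
      star (1 / (Real.sqrt (N.factorial : ℝ) : ℂ) * χ π) = 1 := by
  have h : ∀ π : Equiv.Perm (Fin N), (1 / (Real.sqrt (N.factorial : ℝ) : ℂ) * χ π) *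
      star (1 / (Real.sqrt (N.factorial : ℝ) : ℂ) * χ π) = ((N.factorial : ℝ) : ℂ)⁻¹ := by
    intro π
    rw [star_mul', mul_mul_mul_comm, hχ, mul_one]
    have hs : star (1 / (Real.sqrt (N.factorial : ℝ) : ℂ)) =
        1 / (Real.sqrt (N.factorial : ℝ) : ℂ) := by simp
    rw [hs, div_mul_div_comm, one_mul, ← Complex.ofReal_mul,
      Real.mul_self_sqrt (Nat.cast_nonneg _), one_div]
  rw [Finset.sum_congr rfl fun π _ => h π, Finset.sum_const, Finset.card_univ,
    Fintype.card_perm, Fintype.card_fin, nsmul_eq_mul]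
  have : (N.factorial : ℂ) ≠ 0 := by exact_mod_cast N.factorial_ne_zero
  push_cast
  exact mul_inv_cancel₀ this

theorem dicke_eq_orbitVec (l : Assignment N M) :
    dicke l = orbitVec l fun _ => 1 / (Real.sqrt (N.factorial : ℝ) : ℂ) * 1 := by
  simp only [dicke, orbitVec, permOp_mulVec_ket, Finset.smul_sum, mul_one]

theorem antisymState_eq_orbitVec (l : Assignment N M) :
    antisymState l = orbitVec l fun π =>
      1 / (Real.sqrt (N.factorial : ℝ) : ℂ) * ((Equiv.Perm.sign π : ℤ) : ℂ) := by
  simp only [antisymState, orbitVec, permOp_mulVec_ket, Finset.smul_sum, smul_smul]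

theorem sign_mul_star_sign (π : Equiv.Perm (Fin N)) :
    ((Equiv.Perm.sign π : ℤ) : ℂ) * star ((Equiv.Perm.sign π : ℤ) : ℂ) = 1 := by
  rcases Int.units_eq_one_or (Equiv.Perm.sign π) with h | h <;> simp [h]

theorem permOp_mulVec_dicke (l : Assignment N M) (π : Equiv.Perm (Fin N)) :
    (permOp M π).mulVec (dicke l) = dicke l := by
  rw [dicke_eq_orbitVec, permOp_mulVec_orbitVec]

theorem permOp_mulVec_antisymState (l : Assignment N M) (π : Equiv.Perm (Fin N)) :
    (permOp M π).mulVec (antisymState l) =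
      ((Equiv.Perm.sign π : ℤ) : ℂ) • antisymState l := by
  rw [antisymState_eq_orbitVec, permOp_mulVec_orbitVec]
  simp only [orbitVec, Finset.smul_sum, smul_smul]
  refine Finset.sum_congr rfl fun σ _ => ?_
  rw [Equiv.Perm.sign_mul, Equiv.Perm.sign_inv]
  push_cast
  congr 1
  ring

theorem ketbra_dicke_mem {l : Assignment N M} (hl : Function.Injective l) :
    ketbra (dicke l) ∈ InvFixed N (occupation l) := by
  refine ⟨⟨ketbra_permInvariant (fun _ => 1) (by simp) fun π => by
    rw [permOp_mulVec_dicke, one_smul], ketbra_posSemidef _, ?_⟩, fun j => ?_⟩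
  · rw [dicke_eq_orbitVec, trace_ketbra_orbitVec hl]
    exact inv_sqrt_factorial_sum N (fun _ => 1) (by simp)
  · rw [dicke_eq_orbitVec]
    exact mul_ketbra_eq (numberOp_mulVec_orbitVec _ _ _)

theorem ketbra_antisymState_mem {l : Assignment N M} (hl : Function.Injective l) :
    ketbra (antisymState l) ∈ InvFixed N (occupation l) := by
  refine ⟨⟨ketbra_permInvariant _ sign_mul_star_sign (permOp_mulVec_antisymState l),
    ketbra_posSemidef _, ?_⟩, fun j => ?_⟩
  · rw [antisymState_eq_orbitVec, trace_ketbra_orbitVec hl]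
    exact inv_sqrt_factorial_sum N _ sign_mul_star_sign
  · rw [antisymState_eq_orbitVec]
    exact mul_ketbra_eq (numberOp_mulVec_orbitVec _ _ _)

theorem symOn_mul_of_fixed {ρ : Op N M} (h : ∀ π, permOp M π * ρ = ρ) (A : Finset (Fin N)) :
    symOn M A * ρ = ρ := by
  rw [symOn, Matrix.smul_mul, Finset.sum_mul, Finset.sum_congr rfl fun π _ => h π,
    Finset.sum_const, ← Nat.cast_smul_eq_nsmul ℂ, smul_smul, inv_mul_cancel₀, one_smul]
  exact_mod_cast (permsWithin_card_pos A).ne'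

theorem expect_symOn_of_fixed {v : Vec N M} (h : ∀ π, (permOp M π).mulVec v = v)
    (hv : (ketbra v).trace = 1) (A : Finset (Fin N)) : expect (symOn M A) (ketbra v) = 1 := by
  rw [expect, symOn_mul_of_fixed, hv, Complex.one_re]
  intro π
  rw [ketbra, Matrix.mul_vecMulVec, h]

/-- The symmetrizer absorbs a swap that the state turns into a factor -1, so their product equals
its own negative. -/
theorem expect_symOn_ketbra_antisymState (l : Assignment N M) {A : Finset (Fin N)} {i j : Fin N}
    (hi : i ∈ A) (hj : j ∈ A) (hij : i ≠ j) :
    expect (symOn M A) (ketbra (antisymState l)) = 0 := by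
  have h1 := mul_ketbra_eq (permOp_mulVec_antisymState l (Equiv.swap i j))
  have h2 : symOn M A * ketbra (antisymState l) = -(symOn M A * ketbra (antisymState l)) := by
    conv_lhs => rw [← symOn_mul_permOp (swap_mem_permsWithin hi hj), mul_assoc, h1,
      Equiv.Perm.sign_swap hij]
    simp
  have h3 := congrArg (fun Y => (Matrix.trace Y).re) h2
  simp only [Matrix.trace_neg, Complex.neg_re] at h3
  rw [expect]
  linarith

end States

/-! ### The extremal state of type (N-1,1) -/

section StandardState

variable {N M : ℕ}

/-- The sum of all conjugates of `κ` under the particle permutations. -/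
def twirl (κ : Op N M) : Op N M :=
  ∑ π : Equiv.Perm (Fin N), permOp M π * κ * (permOp M π).conjTranspose

theorem twirl_permInvariant (κ : Op N M) : PermInvariant (twirl κ) := by
  intro σ
  rw [twirl, Finset.mul_sum, Finset.sum_mul]
  refine Fintype.sum_equiv (Equiv.mulRight σ) _ _ fun π => ?_
  rw [Equiv.coe_mulRight, ← permOp_mul, Matrix.conjTranspose_mul]
  simp only [mul_assoc]

theorem twirl_posSemidef {κ : Op N M} (hκ : κ.PosSemidef) : (twirl κ).PosSemidef :=
  Matrix.posSemidef_sum _ fun _ _ => hκ.mul_mul_conjTranspose_same _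

/-- By cyclicity of the trace, an observable commuting with permutations can be evaluated before
twirling. -/
theorem trace_mul_twirl {X : Op N M} (hX : ∀ π, permOp M π * X = X * permOp M π) (κ : Op N M) :
    (X * twirl κ).trace = (N.factorial : ℂ) * (X * κ).trace := by
  rw [twirl, Finset.mul_sum, Matrix.trace_sum, Finset.sum_congr rfl fun π _ => ?_,
    Finset.sum_const, Finset.card_univ, Fintype.card_perm, Fintype.card_fin, nsmul_eq_mul]
  rw [permOp_conjTranspose, ← mul_assoc, ← mul_assoc, ← hX, Matrix.trace_mul_comm, ← mul_assoc,
    ← mul_assoc, permOp_inv_mul, one_mul]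

theorem mul_twirl_eq {X κ : Op N M} {c : ℂ} (hX : ∀ π, permOp M π * X = X * permOp M π)
    (h : X * κ = c • κ) : X * twirl κ = c • twirl κ := by
  rw [twirl, Finset.mul_sum, Finset.smul_sum]
  refine Finset.sum_congr rfl fun π _ => ?_
  rw [← mul_assoc, ← mul_assoc, ← hX, mul_assoc (permOp M π), h, Matrix.mul_smul, Matrix.smul_mul]

theorem permOp_mul_symOn_univ (π : Equiv.Perm (Fin N)) :
    permOp M π * symOn M Finset.univ = symOn M Finset.univ * permOp M π := by
  have h : π ∈ permsWithin Finset.univ := by simp [mem_permsWithin]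
  rw [symOn_mul_permOp h, permOp_mul_symOn h]

/-- The sum of the swaps over all ordered pairs of particles. -/
def swapSum (N M : ℕ) : Op N M := ∑ i : Fin N, ∑ j : Fin N, permOp M (Equiv.swap i j)

theorem permOp_mul_swapSum (π : Equiv.Perm (Fin N)) :
    permOp M π * swapSum N M = swapSum N M * permOp M π := by
  simp only [swapSum, Finset.mul_sum, Finset.sum_mul, permOp_mul]
  refine Fintype.sum_equiv π⁻¹ _ _ fun i => Fintype.sum_equiv π⁻¹ _ _ fun j => ?_
  rw [Equiv.mul_swap_eq_swap_mul]
  simp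

theorem expect_swapSum {ρ : Op N M} (hρ : ρ ∈ Inv N M) {a b : Fin N} (hab : a ≠ b) :
    expect (swapSum N M) ρ =
      N + N * ((N : ℝ) - 1) * expect (permOp M (Equiv.swap a b)) ρ := by
  have hpair : ∀ i j : Fin N, i ≠ j →
      expect (permOp M (Equiv.swap i j)) ρ = expect (permOp M (Equiv.swap a b)) ρ := by
    intro i j hij
    obtain ⟨σ, hσa, hσb⟩ : ∃ σ : Equiv.Perm (Fin N), σ a = i ∧ σ b = j := by
      -- Send `a` to `i`, then move the image of `b` to `j`; the second swap leaves `i` in place.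
      refine ⟨Equiv.swap (Equiv.swap a i b) j * Equiv.swap a i, ?_, ?_⟩
      · rw [Equiv.Perm.mul_apply, Equiv.swap_apply_left, Equiv.swap_apply_of_ne_of_ne _ hij]
        intro h
        have h2 : Equiv.swap a i a = Equiv.swap a i b := by rw [Equiv.swap_apply_left]; exact h
        exact hab ((Equiv.swap a i).injective h2)
      · simp
    have hconj : permOp M σ⁻¹ * permOp M (Equiv.swap a b) * permOp M σ⁻¹⁻¹ =
        permOp M (Equiv.swap i j) := by
      rw [permOp_mul, permOp_mul, inv_inv, ← mul_assoc, Equiv.mul_swap_eq_swap_mul, hσa, hσb,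
        mul_assoc, mul_inv_cancel, mul_one]
    rw [← hconj, PermInvariant.expect_conj hρ.1]
  have hone : ∀ i : Fin N, expect (permOp M (Equiv.swap i i)) ρ = 1 := by
    intro i
    have h1 : permOp M (Equiv.refl (Fin N)) = 1 := permOp_one
    rw [Equiv.swap_self, h1, expect_one hρ.2.2]
  have hrow : ∀ i : Fin N, ∑ j : Fin N, expect (permOp M (Equiv.swap i j)) ρ =
      1 + ((N : ℝ) - 1) * expect (permOp M (Equiv.swap a b)) ρ := by
    intro i
    rw [← Finset.add_sum_erase _ _ (Finset.mem_univ i), hone,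
      Finset.sum_congr rfl fun j hj => hpair i j (Finset.ne_of_mem_erase hj).symm,
      Finset.sum_const, Finset.card_erase_of_mem (Finset.mem_univ i), Finset.card_univ,
      Fintype.card_fin, nsmul_eq_mul, Nat.cast_sub (by have := i.2; lia), Nat.cast_one]
  simp only [swapSum, expect_sum, hrow, Finset.sum_const, Finset.card_univ, Fintype.card_fin,
    nsmul_eq_mul]
  ring

/-- The projector onto the vectors that are symmetric in all particles but `i` and orthogonal to
the totally symmetric ones. -/
noncomputable def stdProj (M : ℕ) (i : Fin N) : Op N M :=
  symOn M (Finset.univ.erase i) - symOn M Finset.univ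

theorem stdProj_conjTranspose (i : Fin N) : (stdProj M i).conjTranspose = stdProj M i := by
  rw [stdProj, Matrix.conjTranspose_sub, symOn_conjTranspose, symOn_conjTranspose]

theorem symOn_univ_mul_stdProj (i : Fin N) : symOn M Finset.univ * stdProj M i = 0 := by
  rw [stdProj, mul_sub, symOn_mul_symOn (Finset.subset_univ _),
    symOn_mul_symOn (Finset.subset_univ _), sub_self]

/-- `swapSum` commutes with all permutations, so it acts as a scalar on each isotypic part; on type
(N-1,1) the scalar is N(N-2). -/
theorem stdProj_mul_swapSum (i : Fin N) :
    stdProj M i * swapSum N M = ((N : ℂ) * ((N : ℂ) - 2)) • stdProj M i := by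
  have hrow := sum_symOn_erase_mul_swap (M := M) (Finset.mem_univ i)
  rw [Finset.card_univ, Fintype.card_fin] at hrow
  -- The symmetrizer omitting `i` absorbs every swap (k j) with j ≠ i, including the identity at j =
  -- k.
  have hcol : ∀ k ∈ Finset.univ.erase i,
      ∑ j, symOn M (Finset.univ.erase i) * permOp M (Equiv.swap k j) =
        symOn M (Finset.univ.erase i) * permOp M (Equiv.swap i k) +
          ((N : ℂ) - 1) • symOn M (Finset.univ.erase i) := by
    intro k hk
    rw [← Finset.add_sum_erase _ _ (Finset.mem_univ i), Equiv.swap_comm k i,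
      Finset.sum_congr rfl fun j hj => symOn_mul_permOp (swap_mem_permsWithin hk hj),
      Finset.sum_const, Finset.card_erase_of_mem (Finset.mem_univ i), Finset.card_univ,
      Fintype.card_fin, ← Nat.cast_smul_eq_nsmul ℂ, Nat.cast_sub (by have := i.2; lia),
      Nat.cast_one]
  have hP : symOn M Finset.univ * swapSum N M =
      ((N : ℂ) * (N : ℂ)) • symOn M (Finset.univ : Finset (Fin N)) := by
    simp only [swapSum, Finset.mul_sum,
      symOn_mul_permOp (swap_mem_permsWithin (Finset.mem_univ _) (Finset.mem_univ _)),
      Finset.sum_const, Finset.card_univ, Fintype.card_fin, ← Nat.cast_smul_eq_nsmul ℂ, smul_smul]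
  have hQ : symOn M (Finset.univ.erase i) * swapSum N M =
      (2 * (N : ℂ)) • symOn M Finset.univ +
        ((N : ℂ) * ((N : ℂ) - 2)) • symOn M (Finset.univ.erase i) := by
    have h1 : permOp M (Equiv.refl (Fin N)) = 1 := permOp_one
    simp only [swapSum, Finset.mul_sum]
    rw [← Finset.add_sum_erase _ _ (Finset.mem_univ i), hrow, Finset.sum_congr rfl hcol,
      Finset.sum_add_distrib, Finset.sum_const, Finset.card_erase_of_mem (Finset.mem_univ i),
      Finset.card_univ, Fintype.card_fin, ← Nat.cast_smul_eq_nsmul ℂ,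
      Nat.cast_sub (by have := i.2; lia), Nat.cast_one]
    rw [← Finset.add_sum_erase _ _ (Finset.mem_univ i), Equiv.swap_self, h1, mul_one] at hrow
    rw [eq_sub_of_add_eq' hrow]
    module
  rw [stdProj, sub_mul, hP, hQ]
  module

theorem symOn_apply (A : Finset (Fin N)) (a b : Assignment N M) :
    symOn M A a b = ((permsWithin A).card : ℂ)⁻¹ *
      (((permsWithin A).filter fun π : Equiv.Perm (Fin N) => a = b ∘ π).card : ℂ) := by
  rw [symOn, Matrix.smul_apply, Matrix.sum_apply, smul_eq_mul]
  simp [permOp, Finset.sum_boole]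

/-- Test the component at `l ∘ swap i j`: the symmetrizer fixing `i` cannot reach it, since mode `l
i` occurs only once, while the full symmetrizer does. -/
theorem stdProj_mulVec_ket_ne_zero {l : Assignment N M} {i j : Fin N} (hij : i ≠ j)
    (hl : ∀ k, k ≠ i → l i ≠ l k) : (stdProj M i).mulVec (ket l) ≠ 0 := by
  intro h
  have h1 := congrFun h (l ∘ Equiv.swap i j)
  rw [ket, Matrix.mulVec_single_one, Pi.zero_apply, Matrix.col_apply, stdProj, Matrix.sub_apply,
    symOn_apply, symOn_apply, Finset.filter_false_of_mem, Finset.card_empty, Nat.cast_zero,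
    mul_zero, zero_sub, neg_eq_zero, mul_eq_zero, inv_eq_zero, Nat.cast_eq_zero,
    Nat.cast_eq_zero, Finset.card_eq_zero, Finset.card_eq_zero] at h1
  · rcases h1 with h1 | h1
    · exact Finset.ne_empty_of_mem (one_mem_permsWithin _) h1
    · have : Equiv.swap i j ∈ (permsWithin (Finset.univ : Finset (Fin N))).filter
          fun π : Equiv.Perm (Fin N) => l ∘ Equiv.swap i j = l ∘ π :=
        Finset.mem_filter.2 ⟨swap_mem_permsWithin (by simp) (by simp), rfl⟩
      simp [h1] at this
  · intro π hπ he
    have h2 := congrFun he i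
    rw [Function.comp_apply, Function.comp_apply, Equiv.swap_apply_left,
      mem_permsWithin.1 hπ i (by simp)] at h2
    exact hl j hij.symm h2.symm

theorem numberOp_mul_stdProj (i : Fin N) (j : Fin M) :
    numberOp N j * stdProj M i = stdProj M i * numberOp N j := by
  simp only [stdProj, symOn, mul_sub, sub_mul, Matrix.mul_smul, Matrix.smul_mul, Finset.mul_sum,
    Finset.sum_mul, numberOp_mul_permOp]

/-- A state supported in the irreducible representation of shape `(N - 1, 1)`: it has no
symmetric part, and the largest two-particle symmetric weight with that property. -/
theorem exists_standard_state {l : Assignment N M} {i : Fin N} (hl : ∀ k, k ≠ i → l i ≠ l k)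
    {a b : Fin N} (hab : a ≠ b) :
    ∃ τ ∈ InvFixed N (occupation l), expect (symOn M Finset.univ) τ = 0 ∧
      ((N : ℝ) - 1) * expect (symOn M {a, b}) τ = (N : ℝ) - 2 := by
  obtain ⟨j, hij⟩ : ∃ j, i ≠ j := by
    by_cases h : i = a
    · exact ⟨b, h ▸ hab⟩
    · exact ⟨a, h⟩
  -- The state is the normalized twirl of the projected basis vector.
  set v := (stdProj M i).mulVec (ket l) with hv
  have hκ : ketbra v = stdProj M i * ketbra (ket l) * stdProj M i := by
    rw [hv, ← mul_ketbra_mul, stdProj_conjTranspose]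
  have htr : (twirl (ketbra v)).trace = (N.factorial : ℂ) * (ketbra v).trace := by
    simpa using trace_mul_twirl (X := 1) (by simp) (ketbra v)
  have hpsd := twirl_posSemidef (ketbra_posSemidef v)
  have hne : (twirl (ketbra v)).trace ≠ 0 := by
    rw [htr, ketbra, Matrix.trace_vecMulVec]
    refine mul_ne_zero (by exact_mod_cast N.factorial_ne_zero) ?_
    rw [Ne, dotProduct_comm, dotProduct_star_self_eq_zero]
    exact stdProj_mulVec_ket_ne_zero hij hl
  obtain ⟨t, ht⟩ : ∃ t : ℝ, (twirl (ketbra v)).trace = t :=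
    ⟨_, Complex.eq_re_of_ofReal_le hpsd.trace_nonneg⟩
  have ht0 : 0 < t := by
    have h0 := hpsd.trace_nonneg
    rw [ht] at h0 hne
    exact lt_of_le_of_ne (by exact_mod_cast h0) (by exact_mod_cast hne.symm)
  have hinv : ((t⁻¹ : ℝ) : ℂ) • twirl (ketbra v) ∈ Inv N M := by
    refine ⟨fun π => ?_, hpsd.smul (by exact_mod_cast (inv_pos.2 ht0).le), ?_⟩
    · rw [Matrix.mul_smul, Matrix.smul_mul, twirl_permInvariant]
    · rw [Matrix.trace_smul, ht, smul_eq_mul, ← Complex.ofReal_mul, inv_mul_cancel₀ ht0.ne',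
        Complex.ofReal_one]
  refine ⟨_, ⟨hinv, fun k => ?_⟩, ?_, ?_⟩
  · rw [Matrix.mul_smul, mul_twirl_eq (c := occupation l k)
      (fun π => (numberOp_mul_permOp π k).symm), smul_comm]
    refine mul_ketbra_eq ?_
    rw [hv, Matrix.mulVec_mulVec, numberOp_mul_stdProj, ← Matrix.mulVec_mulVec,
      numberOp_mulVec_ket, Matrix.mulVec_smul]
  · rw [expect_smul_right, expect, trace_mul_twirl permOp_mul_symOn_univ, hκ, mul_assoc,
      ← mul_assoc (symOn _ _), symOn_univ_mul_stdProj]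
    simp
  · have hJ : expect (swapSum N M) (((t⁻¹ : ℝ) : ℂ) • twirl (ketbra v)) =
        (N : ℝ) * ((N : ℝ) - 2) := by
      have h1 : (swapSum N M * ketbra v).trace =
          ((N : ℂ) * ((N : ℂ) - 2)) * (ketbra v).trace := by
        conv_lhs => rw [hκ, Matrix.trace_mul_comm, mul_assoc, stdProj_mul_swapSum]
        rw [Matrix.mul_smul, ← hκ, Matrix.trace_smul, smul_eq_mul]
      rw [expect_smul_right, expect, trace_mul_twirl permOp_mul_swapSum, h1, mul_left_comm, ← htr,
        ht]
      have h2 : ((N : ℂ) * ((N : ℂ) - 2)) * (t : ℂ) =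
          (((N : ℝ) * ((N : ℝ) - 2) * t : ℝ) : ℂ) := by push_cast; ring
      rw [h2, Complex.ofReal_re]
      field_simp
    have hN : (0 : ℝ) < N := by exact_mod_cast (Nat.zero_le _).trans_lt a.2
    -- With s the expectation of one swap, N + N(N-1)s = N(N-2), and p_2 = (1+s)/2.
    rw [expect_swapSum hinv hab] at hJ
    have h12 : (1 / 2 : ℂ) = (((1 / 2 : ℝ)) : ℂ) := by push_cast; rfl
    rw [symOn_pair hab, h12, expect_smul, expect_add, expect_one hinv.2.2]
    have h3 : (N : ℝ) * (1 + ((N : ℝ) - 1) *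
        expect (permOp M (Equiv.swap a b)) (((t⁻¹ : ℝ) : ℂ) • twirl (ketbra v))) =
        (N : ℝ) * ((N : ℝ) - 2) := by linarith
    have h4 := mul_left_cancel₀ hN.ne' h3
    linarith

end StandardState

/-! ### Tightness of the bounds -/

section Tightness

variable {N M : ℕ}

theorem symWeight_mix {k : ℕ} (h : k ≤ N) (α : ℝ) (ρ σ : Op N M) :
    symWeight h (mix α ρ σ) = α * symWeight h ρ + (1 - α) * symWeight h σ :=
  expect_mix (symProjFirst M h) α ρ σ

theorem symWeight_dicke (hN : 2 ≤ N) {l : Assignment N M} (hl : Function.Injective l) :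
    symWeight hN (ketbra (dicke l)) = 1 ∧ symWeight (le_refl N) (ketbra (dicke l)) = 1 := by
  rw [symWeight_two, symWeight_refl]
  have h := (ketbra_dicke_mem hl).1.2.2
  exact ⟨expect_symOn_of_fixed (permOp_mulVec_dicke l) h _,
    expect_symOn_of_fixed (permOp_mulVec_dicke l) h _⟩

theorem symWeight_antisymState (hN : 2 ≤ N) (l : Assignment N M) :
    symWeight hN (ketbra (antisymState l)) = 0 ∧
      symWeight (le_refl N) (ketbra (antisymState l)) = 0 := by
  rw [symWeight_two, symWeight_refl]
  have hne : (⟨0, by lia⟩ : Fin N) ≠ ⟨1, by lia⟩ := by simp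
  exact ⟨expect_symOn_ketbra_antisymState l (by simp) (by simp) hne,
    expect_symOn_ketbra_antisymState l (by simp) (by simp) hne⟩

theorem exists_symWeight_critical (hN : 2 ≤ N) {l : Assignment N M} {i : Fin N}
    (hl : ∀ k, k ≠ i → l i ≠ l k) :
    ∃ τ ∈ InvFixed N (occupation l), symWeight (le_refl N) τ = 0 ∧
      symWeight hN τ = ((N : ℝ) - 2) / ((N : ℝ) - 1) := by
  have hne : (⟨0, by lia⟩ : Fin N) ≠ ⟨1, by lia⟩ := by simp
  obtain ⟨τ, hτ, h0, h2⟩ := exists_standard_state hl hne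
  have hN' : (2 : ℝ) ≤ N := by exact_mod_cast hN
  refine ⟨τ, hτ, by rw [symWeight_refl, h0], ?_⟩
  rw [symWeight_two, eq_div_iff (by linarith), ← h2, mul_comm]

theorem symWeight_le_one (hN : 2 ≤ N) {ρ : Op N M} (hρ : ρ ∈ Inv N M) : symWeight hN ρ ≤ 1 := by
  rw [symWeight_two]
  exact expect_symOn_le_one hρ (by simp)

/-- The part of a state orthogonal to the totally symmetric vectors. -/
theorem exists_symWeight_zero_le (hN : 2 ≤ N) {ρ : Op N M} (hρ : ρ ∈ Inv N M)
    (hlt : symWeight hN ρ < 1) :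
    ∃ σ ∈ Inv N M, symWeight (le_refl N) σ = 0 ∧ symWeight hN σ ≤ symWeight hN ρ := by
  have hle := symWeight_le hN hρ
  rw [symWeight_two] at hlt
  rw [symWeight_refl, symWeight_two] at hle
  set P := symOn M (Finset.univ : Finset (Fin N)) with hP
  set A : Finset (Fin N) := {⟨0, by lia⟩, ⟨1, by lia⟩}
  have hPP : P * P = P := symOn_mul_symOn (Finset.Subset.refl _)
  have hQP : symOn M A * P = P := symOn_mul_symOn' (Finset.subset_univ _)
  have hPρ : P * ρ = ρ * P := PermInvariant.commute_symOn hρ.1 _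
  set c : ℝ := 1 - expect P ρ with hc
  have hc0 : 0 < c := by linarith
  -- Since `P` commutes with `ρ`, the compression to the complement of `P` is one-sided.
  have hcomm : (1 - P) * ρ * (1 - P) = (1 - P) * ρ := by
    rw [mul_assoc, mul_sub, mul_one, ← hPρ, ← one_sub_mul, ← mul_assoc]
    congr 1
    rw [mul_sub, sub_mul, sub_mul, hPP]
    simp
  have hpsd : ((1 - P) * ρ).PosSemidef := by
    have h := hρ.2.1.mul_mul_conjTranspose_same (1 - P)
    rwa [Matrix.conjTranspose_sub, Matrix.conjTranspose_one, symOn_conjTranspose, hcomm] at h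
  have hval : ∀ X : Op N M, expect X (((c⁻¹ : ℝ) : ℂ) • ((1 - P) * ρ)) =
      c⁻¹ * (expect X ρ - expect (X * P) ρ) := by
    intro X
    rw [expect_smul_right, ← expect_sub]
    congr 1
    rw [expect, expect, ← mul_assoc, mul_sub, mul_one]
  refine ⟨((c⁻¹ : ℝ) : ℂ) • ((1 - P) * ρ), ⟨fun π => ?_, hpsd.smul
    (by exact_mod_cast (inv_pos.2 hc0).le), ?_⟩, ?_, ?_⟩
  · have hcommπ : permOp M π * (1 - P) = (1 - P) * permOp M π := by
      rw [mul_sub, sub_mul, hP, permOp_mul_symOn_univ, mul_one, one_mul]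
    rw [Matrix.mul_smul, Matrix.smul_mul, ← mul_assoc, hcommπ, mul_assoc (1 - P),
      mul_assoc (1 - P), hρ.1 π]
  · have him : (((1 - P) * ρ).trace).im = 0 := by
      have := hpsd.trace_nonneg
      exact ((Complex.le_def.1 this).2).symm
    have hre : (((1 - P) * ρ).trace).re = c := by
      have h : expect (1 - P) ρ = c := by rw [expect_sub, expect_one hρ.2.2]
      exact h
    have htr : ((1 - P) * ρ).trace = (c : ℂ) := Complex.ext hre him
    rw [Matrix.trace_smul, htr, smul_eq_mul, ← Complex.ofReal_mul, inv_mul_cancel₀ hc0.ne',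
      Complex.ofReal_one]
  · rw [symWeight_refl, ← hP, hval, hPP, sub_self, mul_zero]
  · rw [symWeight_two, symWeight_two, hval, hQP, inv_mul_le_iff₀ hc0]
    -- The new p_2 is (p_2 - p_N)/(1 - p_N), which is at most p_2 because p_2 < 1 and p_N ≥ 0.
    have h0 := expect_symOn_nonneg hρ.2.1 (Finset.univ : Finset (Fin N))
    nlinarith

/-- `δ` is symmetric, `τ` sits at the kink, and `ς` has no symmetric part and p_2 at most q. Below
the kink mix `τ` and `ς`; above it mix `δ` and `τ`. Only convexity of `S` enters, so `Inv` and
`InvFixed` are treated alike. -/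
theorem exists_attains_lowerBound (hN : 2 ≤ N) {S : Set (Op N M)}
    (hmix : ∀ α : ℝ, 0 ≤ α → α ≤ 1 → ∀ ρ ∈ S, ∀ σ ∈ S, mix α ρ σ ∈ S)
    {δ τ ς : Op N M} (hδ : δ ∈ S) (hτ : τ ∈ S)
    (hδ2 : symWeight hN δ = 1) (hδN : symWeight (le_refl N) δ = 1)
    (hτ2 : symWeight hN τ = ((N : ℝ) - 2) / ((N : ℝ) - 1)) (hτN : symWeight (le_refl N) τ = 0)
    {q : ℝ} (hq : q ≤ 1)
    (hς : q ≤ ((N : ℝ) - 2) / ((N : ℝ) - 1) →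
      ς ∈ S ∧ symWeight hN ς ≤ q ∧ symWeight (le_refl N) ς = 0) :
    ∃ σ ∈ S, mix (lowerBound N q) δ σ ∈ S ∧ symWeight (le_refl N) σ = 0 ∧
      symWeight hN (mix (lowerBound N q) δ σ) = q ∧
      symWeight (le_refl N) (mix (lowerBound N q) δ σ) = lowerBound N q := by
  have hN' : (0 : ℝ) < (N : ℝ) - 1 := by
    have : (2 : ℝ) ≤ N := by exact_mod_cast hN
    linarith
  by_cases h : q ≤ ((N : ℝ) - 2) / ((N : ℝ) - 1)
  · obtain ⟨hςS, hς2, hςN⟩ := hς h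
    obtain ⟨r, hr0, hr1, hr⟩ := exists_mix_eq hς2 h
    have hσ := hmix r hr0 hr1 τ hτ ς hςS
    have hb : lowerBound N q = 0 := if_pos h
    refine ⟨mix r τ ς, hσ, ?_⟩
    have hσN : symWeight (le_refl N) (mix r τ ς) = 0 := by
      rw [symWeight_mix, hτN, hςN]
      ring
    rw [hb, symWeight_mix hN 0, symWeight_mix (le_refl N) 0, hσN, symWeight_mix hN r, hτ2, hr]
    exact ⟨hmix 0 le_rfl zero_le_one δ hδ _ hσ, rfl, by ring, by ring⟩
  · have hb : lowerBound N q = ((N : ℝ) - 1) * q - ((N : ℝ) - 2) := if_neg h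
    have hb0 : 0 ≤ lowerBound N q := by
      rw [lowerBound_eq_max hN]
      exact le_max_left _ _
    have hb1 : lowerBound N q ≤ 1 := by
      rw [hb]
      nlinarith
    refine ⟨τ, hτ, hmix _ hb0 hb1 δ hδ τ hτ, hτN, ?_, ?_⟩
    · rw [symWeight_mix, hδ2, hτ2, hb]
      field_simp
      ring
    · rw [symWeight_mix, hδN, hτN]
      ring

theorem symWeight_of_subsingleton [Subsingleton (Fin M)] (hN : 2 ≤ N) {ρ : Op N M}
    (hρ : ρ ∈ Inv N M) : symWeight hN ρ = 1 ∧ symWeight (le_refl N) ρ = 1 := by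
  have hU : ∀ π : Equiv.Perm (Fin N), permOp M π * ρ = ρ := by
    intro π
    have h : permOp M π = 1 := by
      ext a b
      have hab : a = b := Subsingleton.elim _ _
      have hab' : b = b ∘ π := Subsingleton.elim _ _
      simp [permOp, Matrix.one_apply, hab, ← hab']
    rw [h, one_mul]
  rw [symWeight_two, symWeight_refl, expect, expect, symOn_mul_of_fixed hU, symOn_mul_of_fixed hU,
    hρ.2.2]
  simp

theorem ketbra_ket_const_mem (j : Fin M) :
    ketbra (ket fun _ : Fin N => j) ∈ Inv N M ∧
      ∀ A : Finset (Fin N), expect (symOn M A) (ketbra (ket fun _ : Fin N => j)) = 1 := by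
  have hU : ∀ π : Equiv.Perm (Fin N),
      (permOp M π).mulVec (ket fun _ : Fin N => j) = ket fun _ : Fin N => j := fun π => by
    rw [permOp_mulVec_ket]
    rfl
  have htr : (ketbra (ket fun _ : Fin N => j)).trace = 1 := by
    rw [ketbra, Matrix.trace_vecMulVec, ket, single_dotProduct]
    simp
  exact ⟨⟨ketbra_permInvariant (fun _ => 1) (by simp) fun π => by rw [hU, one_smul],
    ketbra_posSemidef _, htr⟩, expect_symOn_of_fixed hU htr⟩

theorem isLeast_weightValues_of_mem (hN : 2 ≤ N) {ρ : Op N M} (hρ : ρ ∈ Inv N M) :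
    IsLeast (weightValues hN (Inv N M) (symWeight hN ρ)) (lowerBound N (symWeight hN ρ)) := by
  constructor
  swap
  · rintro x ⟨σ, hσ, h2, rfl⟩
    rw [← h2]
    exact lowerBound_le_symWeight hN hσ
  -- With at most one mode, permutations act trivially and only q = 1 can occur.
  by_cases hM : Subsingleton (Fin M)
  · obtain ⟨h2, hn⟩ := symWeight_of_subsingleton hN hρ
    refine ⟨ρ, hρ, rfl, ?_⟩
    rw [hn, h2, lowerBound_eq_max hN, max_eq_right] <;> linarith
  · rw [not_subsingleton_iff_nontrivial] at hM
    obtain ⟨x, y, hxy⟩ := hM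
    let i : Fin N := ⟨0, by lia⟩
    -- Two modes suffice for the kink state: one particle in `x`, all others in `y`.
    have hl : ∀ k, k ≠ i → (Function.update (fun _ => y) i x : Assignment N M) i ≠
        (Function.update (fun _ => y) i x : Assignment N M) k := by
      intro k hk
      rw [Function.update_self, Function.update_of_ne hk]
      exact hxy
    obtain ⟨τ, hτ, hτN, hτ2⟩ := exists_symWeight_critical hN hl
    obtain ⟨hδ, hδ1⟩ := ketbra_ket_const_mem (N := N) x
    have hq1 : ((N : ℝ) - 2) / ((N : ℝ) - 1) < 1 := by
      have : (2 : ℝ) ≤ N := by exact_mod_cast hN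
      rw [div_lt_one] <;> linarith
    obtain ⟨ς, hς⟩ : ∃ ς : Op N M, symWeight hN ρ ≤ ((N : ℝ) - 2) / ((N : ℝ) - 1) →
        ς ∈ Inv N M ∧ symWeight hN ς ≤ symWeight hN ρ ∧ symWeight (le_refl N) ς = 0 := by
      by_cases h : symWeight hN ρ ≤ ((N : ℝ) - 2) / ((N : ℝ) - 1)
      · obtain ⟨ς, h1, h2, h3⟩ := exists_symWeight_zero_le hN hρ (h.trans_lt hq1)
        exact ⟨ς, fun _ => ⟨h1, h3, h2⟩⟩
      · exact ⟨ρ, fun h' => absurd h' h⟩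
    obtain ⟨σ, -, hm, -, h2, hn⟩ := exists_attains_lowerBound hN
      (fun α h0 h1 ρ hρ σ hσ => mix_mem_Inv h0 h1 hρ hσ) hδ hτ.1
      (by rw [symWeight_two, hδ1]) (by rw [symWeight_refl, hδ1]) hτ2 hτN
      (symWeight_le_one hN hρ) hς
    exact ⟨_, hm, h2, hn⟩

theorem mix_dicke_antisymState (hN : 2 ≤ N) {l : Assignment N M} (hl : Function.Injective l)
    {q : ℝ} (hq : q ∈ Set.Icc (0 : ℝ) 1) :
    mix q (ketbra (dicke l)) (ketbra (antisymState l)) ∈ InvFixed N (occupation l) ∧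
      symWeight hN (mix q (ketbra (dicke l)) (ketbra (antisymState l))) = q ∧
      symWeight (le_refl N) (mix q (ketbra (dicke l)) (ketbra (antisymState l))) = q := by
  obtain ⟨hD2, hDN⟩ := symWeight_dicke hN hl
  obtain ⟨hA2, hAN⟩ := symWeight_antisymState hN l
  rw [symWeight_mix, symWeight_mix, hD2, hDN, hA2, hAN]
  exact ⟨mix_mem_InvFixed hq.1 hq.2 (ketbra_dicke_mem hl) (ketbra_antisymState_mem hl),
    by ring, by ring⟩

theorem exists_mix_dicke_attains_lowerBound (hN : 2 ≤ N) {l : Assignment N M}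
    (hl : Function.Injective l) {q : ℝ} (hq : q ∈ Set.Icc (0 : ℝ) 1) :
    ∃ σ ∈ InvFixed N (occupation l),
      mix (lowerBound N q) (ketbra (dicke l)) σ ∈ InvFixed N (occupation l) ∧
      symWeight (le_refl N) σ = 0 ∧
      symWeight hN (mix (lowerBound N q) (ketbra (dicke l)) σ) = q ∧
      symWeight (le_refl N) (mix (lowerBound N q) (ketbra (dicke l)) σ) = lowerBound N q := by
  obtain ⟨hD2, hDN⟩ := symWeight_dicke hN hl
  obtain ⟨hA2, hAN⟩ := symWeight_antisymState hN l
  obtain ⟨τ, hτ, hτN, hτ2⟩ := exists_symWeight_critical hN (l := l) (i := ⟨0, by lia⟩)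
    fun k hk h => hk (hl h).symm
  -- The antisymmetric state serves as `ς`: its p_2 is 0, hence at most any q in the interval.
  exact exists_attains_lowerBound hN
    (fun α h0 h1 ρ hρ σ hσ => mix_mem_InvFixed h0 h1 hρ hσ) (ketbra_dicke_mem hl) hτ hD2 hDN hτ2
    hτN hq.2 fun _ => ⟨ketbra_antisymState_mem hl, hA2.trans_le hq.1, hAN⟩

/-- The bounds hold on all of `Inv` and are attained already in `InvFixed`, so any `S` in between
has the same extrema. -/
theorem isLeast_isGreatest_weightValues (hN : 2 ≤ N) {l : Assignment N M}
    (hl : Function.Injective l) {q : ℝ} (hq : q ∈ Set.Icc (0 : ℝ) 1) {S : Set (Op N M)}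
    (hS : InvFixed N (occupation l) ⊆ S) (hS' : S ⊆ Inv N M) :
    IsLeast (weightValues hN S q) (lowerBound N q) ∧ IsGreatest (weightValues hN S q) q := by
  obtain ⟨σ, -, hm, -, h2, hn⟩ := exists_mix_dicke_attains_lowerBound hN hl hq
  obtain ⟨hm', h2', hn'⟩ := mix_dicke_antisymState hN hl hq
  refine ⟨⟨⟨_, hS hm, h2, hn⟩, ?_⟩, ⟨⟨_, hS hm', h2', hn'⟩, ?_⟩⟩
  · rintro x ⟨ρ, hρ, rfl, rfl⟩
    exact lowerBound_le_symWeight hN (hS' hρ)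
  · rintro x ⟨ρ, hρ, rfl, rfl⟩
    exact symWeight_le hN (hS' hρ)

end Tightness

end Bosons

theorem theorem2 (N M : ℕ) (hN : 2 ≤ N) :
    -- the bounds
    (∀ ρ ∈ Bosons.Inv N M,
      Bosons.lowerBound N (Bosons.symWeight hN ρ) ≤ Bosons.symWeight (le_refl N) ρ ∧
      Bosons.symWeight (le_refl N) ρ ≤ Bosons.symWeight hN ρ) ∧
    -- for every number of modes, the lower bound is the minimum at each value that `p_2` takes
    (∀ ρ ∈ Bosons.Inv N M,
      IsLeast (Bosons.weightValues hN (Bosons.Inv N M) (Bosons.symWeight hN ρ))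
        (Bosons.lowerBound N (Bosons.symWeight hN ρ))) ∧
    -- both bounds are tight at every value in `[0, 1]`
    (N ≤ M → ∀ q ∈ Set.Icc (0 : ℝ) 1,
      IsLeast (Bosons.weightValues hN (Bosons.Inv N M) q) (Bosons.lowerBound N q) ∧
      IsGreatest (Bosons.weightValues hN (Bosons.Inv N M) q) q) ∧
    -- they stay so for a fixed mode occupation, by `N` particles in `N` distinct modes
    (∀ l : Bosons.Assignment N M, Function.Injective l → ∀ q ∈ Set.Icc (0 : ℝ) 1,
      IsLeast (Bosons.weightValues hN (Bosons.InvFixed N (Bosons.occupation l)) q)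
        (Bosons.lowerBound N q) ∧
      IsGreatest (Bosons.weightValues hN (Bosons.InvFixed N (Bosons.occupation l)) q) q ∧
      -- the upper bound is attained by the mixture of the Dicke and the antisymmetric state
      (∃ ρ ∈ Bosons.InvFixed N (Bosons.occupation l),
        ρ = Bosons.mix q (Bosons.ketbra (Bosons.dicke l))
          (Bosons.ketbra (Bosons.antisymState l)) ∧
        Bosons.symWeight hN ρ = q ∧ Bosons.symWeight (le_refl N) ρ = q) ∧
      -- the lower bound is attained by a mixture of the Dicke state, with weight `b`, and a
      -- state of the same mode occupation that has no symmetric part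
      (∃ σ ∈ Bosons.InvFixed N (Bosons.occupation l),
        ∃ ρ ∈ Bosons.InvFixed N (Bosons.occupation l),
        Bosons.symWeight (le_refl N) σ = 0 ∧
        ρ = Bosons.mix (Bosons.lowerBound N q) (Bosons.ketbra (Bosons.dicke l)) σ ∧
        Bosons.symWeight hN ρ = q ∧
        Bosons.symWeight (le_refl N) ρ = Bosons.lowerBound N q)) := by
  refine ⟨fun ρ hρ => ⟨Bosons.lowerBound_le_symWeight hN hρ, Bosons.symWeight_le hN hρ⟩,
    fun ρ hρ => Bosons.isLeast_weightValues_of_mem hN hρ, fun hNM q hq => ?_, fun l hl q hq => ?_⟩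
  · exact Bosons.isLeast_isGreatest_weightValues hN (Fin.castLE_injective hNM) hq
      (fun ρ hρ => hρ.1) subset_rfl
  · obtain ⟨hleast, hgreatest⟩ := Bosons.isLeast_isGreatest_weightValues hN hl hq
      (S := Bosons.InvFixed N (Bosons.occupation l)) subset_rfl fun ρ hρ => hρ.1
    obtain ⟨hm, h2, hn⟩ := Bosons.mix_dicke_antisymState hN hl hq
    obtain ⟨σ, hσ, hm', hσ0, h2', hn'⟩ := Bosons.exists_mix_dicke_attains_lowerBound hN hl hq
    exact ⟨hleast, hgreatest, ⟨_, hm, rfl, h2, hn⟩, ⟨σ, hσ, _, hm', hσ0, rfl, h2', hn'⟩⟩
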